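/- A family of pseudo-segments is a finite set of simple curves in the plane $\mathbb{R}^2$ (images of injective continuous maps $[0,1]\to\mathbb{R}^2$) such that any two distinct curves of the family meet in at most one point. For a finite set $P\subset\mathbb{R}^2$ and a finite set $\mathcal C$ of curves, let $I(P,\mathcal C)=|\{(p,\gamma)\in P\times\mathcal C : p\in\gamma\}|$. Theorem. For every fixed integer $s\ge 3$ there is a sequence $(\delta_n)_{n\ge 1}$ of real numbers with $\delta_n\to 0$ as $n\to\infty$ such that for every integer $n\ge 1$ there exist a set $P$ of $n$ points in the plane and a family $\mathcal C$ of $n$ pseudo-segments with the following two properties. First, there do not exist $s$ distinct points of $P$ such that every pair of them lies on a distinct curve of $\mathcal C$ (that is, such that one can assign to each of the $\binom s2$ pairs a curve of $\mathcal C$ containing both of its points, with different pairs receiving different curves). Second, $$I(P,\mathcal C)\ \ge\ n^{\frac43-\frac{s-1}{3(s^2-s-1)}-\delta_n}.$$ -/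

import Mathlib

/-- The Euclidean plane. -/
abbrev Plane : Type := EuclideanSpace ℝ (Fin 2)

/-- A simple (open, bounded) planar curve, as a point set: the image of an injective continuous map
from the unit interval. -/
def IsSimpleCurve (γ : Set Plane) : Prop :=
  ∃ f : unitInterval → Plane, Continuous f ∧ Function.Injective f ∧ Set.range f = γ

/-- A family of pseudo-segments: simple curves, any two distinct ones meeting in at most one
point. -/
def IsPseudoSegmentFamily (C : Finset (Set Plane)) : Prop :=
  (∀ γ ∈ C, IsSimpleCurve γ) ∧
    ∀ γ₁ ∈ C, ∀ γ₂ ∈ C, γ₁ ≠ γ₂ → (γ₁ ∩ γ₂).Subsingleton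

open Classical in
/-- The number of incidences: pairs `(p, γ)` in `P × C` with `p ∈ γ`. -/
noncomputable def incidences (P : Finset Plane) (C : Finset (Set Plane)) : ℕ :=
  ((P ×ˢ C).filter (fun x => x.1 ∈ x.2)).card

/-- Every pair of points of `S` lies on a distinct curve of `C`: one can assign to every unordered
pair of distinct points of `S` a curve of `C` through both points, different pairs receiving
different curves. -/
def PairsOnDistinctCurves (S : Finset Plane) (C : Finset (Set Plane)) : Prop :=
  ∃ f : Sym2 Plane → Set Plane,
    (∀ u ∈ S, ∀ v ∈ S, u ≠ v → f s(u, v) ∈ C ∧ u ∈ f s(u, v) ∧ v ∈ f s(u, v)) ∧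
    Set.InjOn f {e : Sym2 Plane | ¬ e.IsDiag ∧ ∀ x ∈ e, x ∈ S}

/-! Pseudo-segments are flexible enough to forget incidences: a line can be bent slightly around any
of its points without creating new crossings (`exists_pseudoSegments`). It therefore suffices to
find a large clique-free subset of the incidences of an integer grid.

The grid has O(K³) points, K³ lines and K⁴ incidences. Write s for the clique size. There are O(K⁵)
ordered joined pairs (v, w). Every further point of a clique is joined to both v and w off the line
vw, and the divisor bound leaves only K^(1+o(1)) such points (`exists_commonNeighbors`). So there
are at most K^(s+3+o(1)) cliques (`card_cliqueTuples_le`), each using s(s-1) incidences.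

Keeping each incidence with probability 1/k and deleting one from each surviving clique
(`exists_independent`) leaves about K⁴/k - K^(s+3)/k^(s(s-1)). Taking k near K^((s-1)/(s²-s-1)) and
K³ of order n gives the exponent. -/

/-- A set of (point, line) pairs in `ℤ × ℤ`, the line `(a, b)` being `y = a x + b`, all of whose
members are incident. -/
def IsLineIncidences (E : Finset ((ℤ × ℤ) × (ℤ × ℤ))) : Prop :=
  ∀ e ∈ E, e.1.2 = e.2.1 * e.1.1 + e.2.2

/-- The incidence set `E` contains `s` points such that all pairs lie on distinct lines. -/
def HasClique (E : Finset ((ℤ × ℤ) × (ℤ × ℤ))) (s : ℕ) : Prop :=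
  ∃ (p : Fin s → ℤ × ℤ) (l : Fin s → Fin s → ℤ × ℤ), Function.Injective p ∧
    (∀ i j, i ≠ j → (p i, l i j) ∈ E ∧ l i j = l j i) ∧
    ∀ i j i' j', i ≠ j → i' ≠ j' → l i j = l i' j' → s(i, j) = s(i', j')

/-! ### Bending integer lines into pseudo-segments -/

/-- The line `ℓ`, slightly raised away from the abscissas in `K`. -/
noncomputable def bentLine (K : Set ℝ) (ℓ : ℤ × ℤ) (x : ℝ) : ℝ :=
  ℓ.1 * x + ℓ.2 + 1 / 4 * min 1 (Metric.infDist x K)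

lemma continuous_bentLine (K : Set ℝ) (ℓ : ℤ × ℤ) : Continuous (bentLine K ℓ) := by
  unfold bentLine
  have := Metric.continuous_infDist_pt K
  fun_prop

/-- Each perturbation is 1/4-Lipschitz with values in [0, 1/4]. Distinct integer slopes separate the
lines at rate at least 1, which beats the combined rate 1/2; parallel lines are at least 1 apart. -/
lemma bentLine_agree_subsingleton {K K' : Set ℝ} {ℓ ℓ' : ℤ × ℤ} (h : ℓ ≠ ℓ') {x y : ℝ}
    (hx : bentLine K ℓ x = bentLine K' ℓ' x) (hy : bentLine K ℓ y = bentLine K' ℓ' y) : x = y := by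
  have lip : ∀ (S : Set ℝ) (u v : ℝ),
      min 1 (Metric.infDist u S) ≤ min 1 (Metric.infDist v S) + |u - v| := by
    intro S u v
    have h1 : Metric.infDist u S ≤ Metric.infDist v S + |u - v| := by
      rw [← Real.dist_eq]; exact Metric.infDist_le_infDist_add_dist
    have h2 := abs_nonneg (u - v)
    rcases le_total 1 (Metric.infDist v S) with h3 | h3
    · rw [min_eq_left h3]
      exact (min_le_left _ _).trans (by linarith)
    · rw [min_eq_right h3]
      exact (min_le_right _ _).trans h1
  have bd : ∀ (S : Set ℝ) (u : ℝ),
      0 ≤ min 1 (Metric.infDist u S) ∧ min 1 (Metric.infDist u S) ≤ 1 := fun S u =>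
    ⟨le_min zero_le_one Metric.infDist_nonneg, min_le_left _ _⟩
  unfold bentLine at hx hy
  by_cases hs : ℓ.1 = ℓ'.1
  · exfalso
    have hb : ℓ.2 ≠ ℓ'.2 := fun hb => h (Prod.ext hs hb)
    have e1 := bd K x
    have e2 := bd K' x
    rw [hs] at hx
    have e3 : ((ℓ.2 - ℓ'.2 : ℤ) : ℝ) ≤ 1 / 4 := by push_cast; linarith
    have e4 : (-1 / 4 : ℝ) ≤ ((ℓ.2 - ℓ'.2 : ℤ) : ℝ) := by push_cast; linarith
    have e5 : ((ℓ.2 - ℓ'.2 : ℤ) : ℝ) < ((1 : ℤ) : ℝ) := by push_cast at *; linarith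
    have e6 : ((-1 : ℤ) : ℝ) < ((ℓ.2 - ℓ'.2 : ℤ) : ℝ) := by push_cast at *; linarith
    rw [Int.cast_lt] at e5 e6
    omega
  · by_contra hxy
    have hd : (1 : ℝ) ≤ |((ℓ.1 : ℝ) - ℓ'.1)| := by
      have : (1 : ℤ) ≤ |ℓ.1 - ℓ'.1| := Int.one_le_abs (sub_ne_zero.2 hs)
      exact_mod_cast this
    have a1 := lip K x y
    have a2 := lip K y x
    have a3 := lip K' x y
    have a4 := lip K' y x
    rw [abs_sub_comm y x] at a2 a4
    have hpos : 0 < |x - y| := abs_pos.2 (sub_ne_zero.2 hxy)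
    have key : |((ℓ.1 : ℝ) - ℓ'.1) * (x - y)| ≤ 1 / 2 * |x - y| := by
      rw [abs_le]; constructor <;> linarith
    rw [abs_mul] at key
    nlinarith

/-- The graph of `bentLine K ℓ` over `[-r, r]`. -/
noncomputable def bentSegment (r : ℝ) (K : Set ℝ) (ℓ : ℤ × ℤ) : Set Plane :=
  Set.range fun t : unitInterval =>
    (!₂[r * (2 * (t : ℝ) - 1), bentLine K ℓ (r * (2 * (t : ℝ) - 1))] : Plane)

lemma mem_bentSegment {r : ℝ} (hr : 0 < r) {K : Set ℝ} {ℓ : ℤ × ℤ} {v : Plane} :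
    v ∈ bentSegment r K ℓ ↔ |v 0| ≤ r ∧ v 1 = bentLine K ℓ (v 0) := by
  constructor
  · rintro ⟨t, rfl⟩
    have h0 := t.2.1
    have h1 := t.2.2
    refine ⟨?_, by simp⟩
    simp only [Matrix.cons_val_zero]
    rw [abs_le]
    constructor <;> nlinarith
  · rintro ⟨h0, h1⟩
    rw [abs_le] at h0
    refine ⟨⟨(v 0 / r + 1) / 2, ?_, ?_⟩, ?_⟩
    · have : -1 ≤ v 0 / r := by rw [le_div_iff₀ hr]; linarith
      linarith
    · have : v 0 / r ≤ 1 := by rw [div_le_iff₀ hr]; linarith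
      linarith
    · have e : r * (2 * ((v 0 / r + 1) / 2) - 1) = v 0 := by field_simp; ring
      ext i
      fin_cases i
      · simpa using e
      · simp only [e]
        simpa using h1.symm

lemma isSimpleCurve_bentSegment {r : ℝ} (hr : 0 < r) (K : Set ℝ) (ℓ : ℤ × ℤ) :
    IsSimpleCurve (bentSegment r K ℓ) := by
  refine ⟨_, ?_, ?_, rfl⟩
  · have := continuous_bentLine K ℓ
    refine (PiLp.continuous_toLp 2 _).comp (continuous_pi fun i => ?_)
    fin_cases i
    · simp; fun_prop
    · simp; fun_prop
  · intro t u h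
    have := congrArg (fun v : Plane => v 0) h
    simp only [Matrix.cons_val_zero] at this
    have := mul_left_cancel₀ hr.ne' this
    exact Subtype.ext (by linarith)

lemma bentSegment_inter_subsingleton {r : ℝ} (hr : 0 < r) {K K' : Set ℝ} {ℓ ℓ' : ℤ × ℤ}
    (h : ℓ ≠ ℓ') : (bentSegment r K ℓ ∩ bentSegment r K' ℓ').Subsingleton := by
  rintro u ⟨hu, hu'⟩ v ⟨hv, hv'⟩
  rw [mem_bentSegment hr] at hu hu' hv hv'
  have h0 : u 0 = v 0 :=
    bentLine_agree_subsingleton h (hu.2.symm.trans hu'.2) (hv.2.symm.trans hv'.2)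
  ext i
  fin_cases i
  · exact h0
  · simp only [Fin.mk_one]
    rw [hu.2, hv.2, h0]

lemma bentSegment_nontrivial {r : ℝ} (hr : 0 < r) (K : Set ℝ) (ℓ : ℤ × ℤ) :
    (bentSegment r K ℓ).Nontrivial := by
  refine ⟨!₂[0, bentLine K ℓ 0], ?_, !₂[r, bentLine K ℓ r], ?_, ?_⟩
  · rw [mem_bentSegment hr]; simp [hr.le]
  · rw [mem_bentSegment hr]; simp [abs_of_pos hr]
  · intro h
    have := congrArg (fun v : Plane => v 0) h
    simp at this
    exact hr.ne this

/-- An integer point of the plane. -/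
noncomputable def latticePoint (p : ℤ × ℤ) : Plane := !₂[(p.1 : ℝ), (p.2 : ℝ)]

lemma latticePoint_injective : Function.Injective latticePoint := by
  intro p q h
  have h0 := congrArg (fun v : Plane => v 0) h
  have h1 := congrArg (fun v : Plane => v 1) h
  simp [latticePoint] at h0 h1
  exact Prod.ext h0 h1

/-- The raise is less than 1, so at an integer abscissa it reaches an integer height only when it
vanishes. -/
lemma latticePoint_mem_bentSegment {r : ℝ} (hr : 0 < r) {K : Set ℝ} (hK : IsClosed K)
    (hne : K.Nonempty) {ℓ p : ℤ × ℤ} :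
    latticePoint p ∈ bentSegment r K ℓ ↔
      |(p.1 : ℝ)| ≤ r ∧ (p.1 : ℝ) ∈ K ∧ p.2 = ℓ.1 * p.1 + ℓ.2 := by
  rw [mem_bentSegment hr, hK.mem_iff_infDist_zero hne]
  simp only [latticePoint, PiLp.toLp_apply, Matrix.cons_val_zero, Matrix.cons_val_one]
  refine and_congr_right fun _ => ?_
  unfold bentLine
  have h0 : 0 ≤ Metric.infDist (p.1 : ℝ) K := Metric.infDist_nonneg
  constructor
  · intro h
    have b0 : 0 ≤ min 1 (Metric.infDist (p.1 : ℝ) K) := le_min zero_le_one h0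
    have b1 : min 1 (Metric.infDist (p.1 : ℝ) K) ≤ 1 := min_le_left _ _
    have e1 : ((0 : ℤ) : ℝ) ≤ ((p.2 - (ℓ.1 * p.1 + ℓ.2) : ℤ) : ℝ) := by push_cast; linarith
    have e2 : ((p.2 - (ℓ.1 * p.1 + ℓ.2) : ℤ) : ℝ) < ((1 : ℤ) : ℝ) := by push_cast; linarith
    rw [Int.cast_le] at e1
    rw [Int.cast_lt] at e2
    have e3 : p.2 = ℓ.1 * p.1 + ℓ.2 := by omega
    refine ⟨?_, e3⟩
    rw [e3] at h
    push_cast at h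
    have e4 : min 1 (Metric.infDist (p.1 : ℝ) K) = 0 := by linarith
    rcases min_choice 1 (Metric.infDist (p.1 : ℝ) K) with h5 | h5 <;> rw [h5] at e4
    · norm_num at e4
    · exact e4
  · rintro ⟨h1, h2⟩
    rw [h1, h2]
    simp

/-- Every set of integer point-line incidences is realized by points and pseudo-segments, with
any prescribed numbers of them that are large enough. -/
theorem exists_pseudoSegments {E : Finset ((ℤ × ℤ) × (ℤ × ℤ))} (hE : IsLineIncidences E)
    {s n : ℕ} (hP : (E.image Prod.fst).card ≤ n)
    (hL : (E.image Prod.snd).card ≤ n) (hcl : ¬ HasClique E s) :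
    ∃ (P : Finset Plane) (C : Finset (Set Plane)),
      P.card = n ∧ C.card = n ∧ IsPseudoSegmentFamily C ∧
      (¬ ∃ S : Finset Plane, S ⊆ P ∧ S.card = s ∧ PairsOnDistinctCurves S C) ∧
      incidences P C = E.card := by
  classical
  -- Padding is harmless: the curves will avoid every point of `P'` not prescribed by `E`.
  obtain ⟨P', hPE, hPn⟩ := Infinite.exists_superset_card_eq _ n hP
  obtain ⟨L', hLE, hLn⟩ := Infinite.exists_superset_card_eq _ n hL
  obtain ⟨R, hR⟩ : ∃ R : ℕ, ∀ p ∈ P', p.1.natAbs ≤ R :=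
    ⟨P'.sup fun p => p.1.natAbs, fun p hp => Finset.le_sup (f := fun p : ℤ × ℤ => p.1.natAbs) hp⟩
  set r : ℝ := (R : ℝ) + 1 with hrdef
  have hr : 0 < r := by positivity
  have habs : ∀ p ∈ P', |(p.1 : ℝ)| ≤ R := by
    intro p hp
    rw [← Int.cast_abs, Int.abs_eq_natAbs]
    exact_mod_cast hR p hp
  -- The element `r`, beyond all abscissas of `P'`, keeps the set nonempty: `Metric.infDist` to the
  -- empty set is 0, which would leave the line unbent.
  let K : ℤ × ℤ → Set ℝ := fun ℓ =>
    insert r (((P'.filter fun p => (p, ℓ) ∈ E).image fun p => (p.1 : ℝ) : Finset ℝ) : Set ℝ)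
  have hKc : ∀ ℓ, IsClosed (K ℓ) := fun ℓ => ((Finset.finite_toSet _).insert r).isClosed
  have hKn : ∀ ℓ, (K ℓ).Nonempty := fun ℓ => ⟨r, Set.mem_insert _ _⟩
  let γ : ℤ × ℤ → Set Plane := fun ℓ => bentSegment r (K ℓ) ℓ
  have hmem : ∀ p ∈ P', ∀ ℓ, latticePoint p ∈ γ ℓ ↔ (p, ℓ) ∈ E := by
    intro p hp ℓ
    rw [latticePoint_mem_bentSegment hr (hKc ℓ) (hKn ℓ)]
    have hpR := habs p hp
    constructor
    · rintro ⟨-, h1, h2⟩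
      rcases h1 with h1 | h1
      · rw [h1, abs_of_pos hr] at hpR
        linarith
      · simp only [Finset.coe_image, Set.mem_image, Finset.mem_coe, Finset.mem_filter] at h1
        obtain ⟨q, ⟨-, hq⟩, hqp⟩ := h1
        have e := hE _ hq
        simp only [Int.cast_inj] at hqp e
        have : q = p := Prod.ext hqp (by rw [e, h2, hqp])
        rwa [← this]
    · intro h
      refine ⟨by linarith, Or.inr ?_, hE _ h⟩
      simp only [Finset.coe_image, Set.mem_image, Finset.mem_coe, Finset.mem_filter]
      exact ⟨p, ⟨hp, h⟩, rfl⟩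
  have hinter : ∀ ℓ ℓ', ℓ ≠ ℓ' → (γ ℓ ∩ γ ℓ').Subsingleton := fun ℓ ℓ' h =>
    bentSegment_inter_subsingleton hr h
  have hγinj : Function.Injective γ := by
    intro ℓ ℓ' h
    by_contra hne
    have h1 := hinter ℓ ℓ' hne
    rw [← h, Set.inter_self] at h1
    exact (Set.not_nontrivial_iff.2 h1) (bentSegment_nontrivial hr _ _)
  refine ⟨P'.image latticePoint, L'.image γ, ?_, ?_, ⟨?_, ?_⟩, ?_, ?_⟩
  · rw [Finset.card_image_of_injective _ latticePoint_injective, hPn]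
  · rw [Finset.card_image_of_injective _ hγinj, hLn]
  · intro c hc
    obtain ⟨ℓ, -, rfl⟩ := Finset.mem_image.1 hc
    exact isSimpleCurve_bentSegment hr _ _
  · intro c hc c' hc' hne
    obtain ⟨ℓ, -, rfl⟩ := Finset.mem_image.1 hc
    obtain ⟨ℓ', -, rfl⟩ := Finset.mem_image.1 hc'
    exact hinter ℓ ℓ' fun h => hne (h ▸ rfl)
  · rintro ⟨S, hSP, hSs, f, hf, hfinj⟩
    apply hcl
    have hcard : Fintype.card (Fin s) = Fintype.card S := by simp [hSs]
    let e : Fin s ≃ S := Fintype.equivOfCardEq hcard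
    have hp : ∀ i, ∃ p ∈ P', latticePoint p = (e i : Plane) := fun i =>
      Finset.mem_image.1 (hSP (e i).2)
    choose p hpP hpe using hp
    have hl : ∀ z : Sym2 Plane, f z ∈ L'.image γ → ∃ ℓ ∈ L', γ ℓ = f z := fun z hz =>
      Finset.mem_image.1 hz
    choose! l hlL hlγ using hl
    have hne : ∀ i j, i ≠ j → (e i : Plane) ≠ e j := fun i j hij h =>
      hij (e.injective (Subtype.ext h))
    refine ⟨p, fun i j => l s(e i, e j), ?_, ?_, ?_⟩
    · intro i j hij
      by_contra h
      exact hne i j h (by rw [← hpe, ← hpe, hij])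
    · intro i j hij
      obtain ⟨h1, h2, -⟩ := hf _ (e i).2 _ (e j).2 (hne i j hij)
      refine ⟨?_, congrArg l Sym2.eq_swap⟩
      rw [← hmem _ (hpP i), hlγ _ h1, hpe]
      exact h2
    · intro i j i' j' hij hij' h
      obtain ⟨h1, -⟩ := hf _ (e i).2 _ (e j).2 (hne i j hij)
      obtain ⟨h1', -⟩ := hf _ (e i').2 _ (e j').2 (hne i' j' hij')
      have h2 : f s(e i, e j) = f s(e i', e j') := by
        rw [← hlγ _ h1, ← hlγ _ h1']
        exact congrArg γ h
      have h3 := hfinj (by simpa using fun h => hne i j hij (congrArg _ h))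
        (by simpa using fun h => hne i' j' hij' (congrArg _ h)) h2
      simpa only [Sym2.eq_iff, ← Subtype.ext_iff, e.injective.eq_iff] using h3
  · unfold incidences
    rw [← Finset.card_image_of_injective E
      (latticePoint_injective.prodMap hγinj)]
    congr 1
    ext ⟨u, c⟩
    simp only [Finset.mem_filter, Finset.mem_product, Finset.mem_image, Prod.map_apply,
      Prod.mk.injEq, Prod.exists]
    constructor
    · rintro ⟨⟨⟨x, y, hx, rfl⟩, ⟨a, b, hy, rfl⟩⟩, h⟩
      exact ⟨x, y, a, b, (hmem _ hx _).1 h, rfl, rfl⟩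
    · rintro ⟨x, y, a, b, h, rfl, rfl⟩
      have hx : (x, y) ∈ P' := hPE (Finset.mem_image_of_mem Prod.fst h)
      have hy : (a, b) ∈ L' := hLE (Finset.mem_image_of_mem Prod.snd h)
      exact ⟨⟨⟨x, y, hx, rfl⟩, a, b, hy, rfl⟩, (hmem _ hx _).2 h⟩

/-! ### Random deletion -/

open Classical in
lemma card_colorings_eq_zero_on {α : Type*} [Fintype α] (k : ℕ) [NeZero k] (T : Finset α) :
    (((Finset.univ : Finset (α → Fin k)).filter fun c => ∀ e ∈ T, c e = 0).card : ℝ) =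
      (k : ℝ) ^ Fintype.card α / (k : ℝ) ^ T.card := by
  have h : ((Finset.univ : Finset (α → Fin k)).filter fun c => ∀ e ∈ T, c e = 0) =
      Fintype.piFinset fun e => if e ∈ T then ({0} : Finset (Fin k)) else Finset.univ := by
    ext c
    simp only [Finset.mem_filter, Finset.mem_univ, true_and, Fintype.mem_piFinset]
    refine forall_congr' fun e => ?_
    by_cases he : e ∈ T <;> simp [he]
  have hk : (k : ℝ) ≠ 0 := Nat.cast_ne_zero.2 (NeZero.ne k)
  rw [h, Fintype.card_piFinset, eq_div_iff (pow_ne_zero _ hk)]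
  have h1 : ∀ e, (if e ∈ T then ({0} : Finset (Fin k)) else Finset.univ).card =
      if e ∈ T then 1 else k := by
    intro e; split_ifs <;> simp
  simp only [h1]
  rw [Finset.prod_ite]
  simp only [Finset.prod_const_one, one_mul, Finset.prod_const]
  push_cast
  rw [← pow_add, Finset.filter_not, Finset.filter_mem_eq_inter, Finset.univ_inter,
    ← Finset.compl_eq_univ_sdiff, add_comm, Finset.card_add_card_compl]

/-- Random deletion in a finite type: a uniform hypergraph has a large independent set. -/
lemma exists_independent_fintype {α β : Type*} [Fintype α] (B : Finset β) (T : β → Finset α)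
    {t : ℕ} (ht : 1 ≤ t) (hT : ∀ b ∈ B, (T b).card = t) {k : ℕ} (hk : 1 ≤ k) :
    ∃ A : Finset α, (∀ b ∈ B, ¬ T b ⊆ A) ∧
      (Fintype.card α : ℝ) / k - B.card / (k : ℝ) ^ t ≤ A.card := by
  classical
  have : NeZero k := ⟨by omega⟩
  -- A uniform colouring with `k` colours keeps each element, the class of colour 0, with
  -- probability 1/k; `F c` collects the forbidden sets that survive.
  let Z : (α → Fin k) → Finset α := fun c => Finset.univ.filter fun e => c e = 0
  let F : (α → Fin k) → Finset β := fun c => B.filter fun b => T b ⊆ Z c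
  have s1 : ∑ c, ((Z c).card : ℝ) = (k : ℝ) ^ Fintype.card α * (Fintype.card α / k) := by
    have : ∀ c : α → Fin k, ((Z c).card : ℝ) = ∑ e, if c e = 0 then (1 : ℝ) else 0 := by
      intro c; simp [Z]
    simp only [this]
    rw [Finset.sum_comm]
    have h2 : ∀ e : α, (∑ c : α → Fin k, if c e = 0 then (1 : ℝ) else 0) =
        (k : ℝ) ^ Fintype.card α / k := by
      intro e
      have := card_colorings_eq_zero_on k ({e} : Finset α)
      simp only [Finset.mem_singleton, forall_eq, Finset.card_singleton, pow_one] at this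
      rw [← this]; simp
    simp only [h2, Finset.sum_const, Finset.card_univ, nsmul_eq_mul]
    ring
  have s2 : ∑ c, ((F c).card : ℝ) = (k : ℝ) ^ Fintype.card α * (B.card / (k : ℝ) ^ t) := by
    have : ∀ c : α → Fin k, ((F c).card : ℝ) =
        ∑ b ∈ B, if ∀ e ∈ T b, c e = 0 then (1 : ℝ) else 0 := by
      intro c
      simp [F, Z, Finset.subset_iff]
    simp only [this]
    rw [Finset.sum_comm]
    have h2 : ∀ b ∈ B, (∑ c : α → Fin k, if ∀ e ∈ T b, c e = 0 then (1 : ℝ) else 0) =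
        (k : ℝ) ^ Fintype.card α / (k : ℝ) ^ t := by
      intro b hb
      have := card_colorings_eq_zero_on k (T b)
      rw [hT b hb] at this
      rw [← this]; simp
    rw [Finset.sum_congr rfl h2, Finset.sum_const, nsmul_eq_mul]
    ring
  obtain ⟨c, -, hc⟩ : ∃ c ∈ (Finset.univ : Finset (α → Fin k)),
      (Fintype.card α : ℝ) / k - B.card / (k : ℝ) ^ t ≤ (Z c).card - (F c).card := by
    apply Finset.exists_le_of_sum_le Finset.univ_nonempty
    rw [Finset.sum_sub_distrib, Finset.sum_sub_distrib, s1, s2]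
    simp only [Finset.sum_const, Finset.card_univ, Fintype.card_fun, Fintype.card_fin,
      nsmul_eq_mul]
    push_cast
    exact le_rfl
  have hne : ∀ b, b ∈ B → (T b).Nonempty := fun b hb => by
    rw [← Finset.card_pos, hT b hb]; omega
  rcases isEmpty_or_nonempty α with hα | hα
  · refine ⟨∅, fun b hb _ => hα.elim (hne b hb).choose, ?_⟩
    have : (0 : ℝ) ≤ B.card / (k : ℝ) ^ t := by positivity
    simpa using this
  choose! x hx using hne
  -- Removing one element from each surviving forbidden set destroys them all.
  refine ⟨Z c \ (F c).image x, ?_, ?_⟩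
  · intro b hb hsub
    have hbF : b ∈ F c := Finset.mem_filter.2 ⟨hb, hsub.trans Finset.sdiff_subset⟩
    exact (Finset.mem_sdiff.1 (hsub (hx b hb))).2 (Finset.mem_image_of_mem x hbF)
  · have h1 := Finset.le_card_sdiff ((F c).image x) (Z c)
    have h2 : ((F c).image x).card ≤ (F c).card := Finset.card_image_le
    have h3 : (Z c).card ≤ (Z c \ (F c).image x).card + (F c).card := by omega
    have h4 : ((Z c).card : ℝ) ≤ (Z c \ (F c).image x).card + (F c).card := by exact_mod_cast h3
    linarith

/-- Random deletion: a `t`-uniform hypergraph has a large independent set. -/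
lemma exists_independent {α β : Type*} (E : Finset α) (B : Finset β)
    (T : β → Finset α) {t : ℕ} (ht : 1 ≤ t) (hT : ∀ b ∈ B, T b ⊆ E ∧ (T b).card = t)
    {k : ℕ} (hk : 1 ≤ k) :
    ∃ A ⊆ E, (∀ b ∈ B, ¬ T b ⊆ A) ∧ (E.card : ℝ) / k - B.card / (k : ℝ) ^ t ≤ A.card := by
  classical
  obtain ⟨A, hA, hcard⟩ := exists_independent_fintype (α := E) B
    (fun b => (T b).subtype (· ∈ E)) ht (fun b hb => by
      rw [Finset.card_subtype, Finset.filter_true_of_mem fun x hx => (hT b hb).1 hx]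
      exact (hT b hb).2) hk
  refine ⟨A.map (Function.Embedding.subtype _), ?_, ?_, ?_⟩
  · intro x hx
    obtain ⟨y, -, rfl⟩ := Finset.mem_map.1 hx
    exact y.2
  · intro b hb hsub
    refine hA b hb fun y hy => ?_
    have := hsub (Finset.mem_subtype.1 hy)
    simpa using this
  · simpa using hcard

/-! ### The divisor bound -/

lemma succ_le_mul_rpow {ε : ℝ} (hε : 0 < ε) {p : ℕ} (hp : 2 ≤ p) (k : ℕ) :
    ((k : ℝ) + 1) ≤ (1 + 1 / (ε * Real.log 2)) * ((p : ℝ) ^ k) ^ ε := by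
  have hl : 0 < Real.log 2 := Real.log_pos (by norm_num)
  have hp' : (2 : ℝ) ≤ p := by exact_mod_cast hp
  have h1 : ((2 : ℝ) ^ k) ^ ε ≤ ((p : ℝ) ^ k) ^ ε := by gcongr
  have h2 : 1 + k * (ε * Real.log 2) ≤ ((2 : ℝ) ^ k) ^ ε := by
    have := Real.add_one_le_exp (k * (ε * Real.log 2))
    rw [← Real.rpow_natCast, ← Real.rpow_mul (by norm_num), Real.rpow_def_of_pos (by norm_num),
      show Real.log 2 * (k * ε) = k * (ε * Real.log 2) by ring]
    linarith
  set a := ε * Real.log 2 with ha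
  have ha0 : 0 < a := by positivity
  calc ((k : ℝ) + 1) ≤ (1 + 1 / a) * (1 + k * a) := by
        have : (1 + 1 / a) * (1 + k * a) = 1 + k * a + 1 / a + k := by field_simp; ring
        rw [this]
        have : 0 ≤ k * a + 1 / a := by positivity
        linarith
    _ ≤ _ := by
        have : (0 : ℝ) ≤ 1 + 1 / a := by positivity
        exact mul_le_mul_of_nonneg_left (h2.trans h1) this

lemma succ_le_rpow {ε : ℝ} {p : ℕ} (hp : 2 ≤ (p : ℝ) ^ ε) (k : ℕ) :
    ((k : ℝ) + 1) ≤ ((p : ℝ) ^ k) ^ ε := by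
  rw [← Real.rpow_natCast, ← Real.rpow_mul (by positivity), mul_comm,
    Real.rpow_mul (by positivity), Real.rpow_natCast]
  calc ((k : ℝ) + 1) ≤ 2 ^ k := by exact_mod_cast Nat.lt_two_pow_self
    _ ≤ _ := by gcongr

/-- The divisor bound. -/
theorem card_divisors_le_rpow {ε : ℝ} (hε : 0 < ε) :
    ∃ C : ℝ, 1 ≤ C ∧ ∀ n : ℕ, n ≠ 0 → (n.divisors.card : ℝ) ≤ C * (n : ℝ) ^ ε := by
  set c : ℝ := 1 + 1 / (ε * Real.log 2) with hc
  have hl : 0 < Real.log 2 := Real.log_pos (by norm_num)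
  have hc1 : 1 ≤ c := by
    have : 0 ≤ 1 / (ε * Real.log 2) := by positivity
    linarith
  -- Primes p ≥ 2^(1/ε) satisfy p^(kε) ≥ 2^k ≥ k + 1 and cost nothing; each of the fewer than `M`
  -- primes below `M` costs a factor `c`.
  obtain ⟨M, hM⟩ := exists_nat_ge ((2 : ℝ) ^ (1 / ε))
  refine ⟨c ^ M, one_le_pow₀ hc1, fun n hn => ?_⟩
  rw [Nat.card_divisors hn]
  push_cast
  have hfac : (n : ℝ) ^ ε = ∏ p ∈ n.primeFactors, ((p : ℝ) ^ (n.factorization p)) ^ ε := by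
    rw [Real.finsetProd_rpow _ _ fun p _ => by positivity]
    congr 1
    conv_lhs => rw [← Nat.prod_factorization_pow_eq_self hn]
    rw [Finsupp.prod, Nat.support_factorization]
    push_cast
    rfl
  have hstep : ∀ p ∈ n.primeFactors, ((n.factorization p : ℝ) + 1) ≤
      (if p < M then c else 1) * ((p : ℝ) ^ (n.factorization p)) ^ ε := by
    intro p hp
    have hp2 := (Nat.prime_of_mem_primeFactors hp).two_le
    split_ifs with h
    · exact succ_le_mul_rpow hε hp2 _
    · rw [one_mul]
      apply succ_le_rpow
      have : (2 : ℝ) ^ (1 / ε) ≤ p := hM.trans (by exact_mod_cast not_lt.1 h)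
      calc (2 : ℝ) = ((2 : ℝ) ^ (1 / ε)) ^ ε := by
            rw [← Real.rpow_mul (by norm_num), one_div_mul_cancel hε.ne', Real.rpow_one]
        _ ≤ _ := by gcongr
  refine (Finset.prod_le_prod (fun p _ => by positivity) hstep).trans ?_
  rw [Finset.prod_mul_distrib, ← hfac]
  gcongr
  rw [Finset.prod_ite]
  simp only [Finset.prod_const, one_pow, mul_one]
  apply pow_le_pow_right₀ hc1
  calc _ ≤ (Finset.range M).card := Finset.card_le_card fun p hp =>
        Finset.mem_range.2 (Finset.mem_filter.1 hp).2
    _ = M := Finset.card_range M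

/-! ### The grid and its cliques -/

/-- The grid incidences: abscissas and slopes in `[0, K)`, intercepts in `[0, K²)`. -/
noncomputable def gridIncidences (K : ℕ) : Finset ((ℤ × ℤ) × (ℤ × ℤ)) :=
  (Finset.Ico (0 : ℤ) K ×ˢ (Finset.Ico (0 : ℤ) K ×ˢ Finset.Ico (0 : ℤ) (K ^ 2))).image
    fun z => ((z.1, z.2.1 * z.1 + z.2.2), z.2)

lemma mem_gridIncidences {K : ℕ} {p ℓ : ℤ × ℤ} :
    (p, ℓ) ∈ gridIncidences K ↔ (0 ≤ p.1 ∧ p.1 < K) ∧ (0 ≤ ℓ.1 ∧ ℓ.1 < K) ∧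
      (0 ≤ ℓ.2 ∧ ℓ.2 < K ^ 2) ∧ p.2 = ℓ.1 * p.1 + ℓ.2 := by
  obtain ⟨x, y⟩ := p
  obtain ⟨a, b⟩ := ℓ
  simp only [gridIncidences, Finset.mem_image, Finset.mem_product, Finset.mem_Ico, Prod.mk.injEq,
    Prod.exists]
  constructor
  · rintro ⟨x', a', b', ⟨h1, h2, h3⟩, ⟨rfl, rfl⟩, rfl, rfl⟩
    exact ⟨h1, h2, h3, rfl⟩
  · rintro ⟨h1, h2, h3, h4⟩
    exact ⟨x, a, b, ⟨h1, h2, h3⟩, ⟨rfl, h4.symm⟩, rfl, rfl⟩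

lemma isLineIncidences_gridIncidences (K : ℕ) : IsLineIncidences (gridIncidences K) :=
  fun _ he => (mem_gridIncidences.1 he).2.2.2

lemma card_gridIncidences (K : ℕ) : (gridIncidences K).card = K ^ 4 := by
  rw [gridIncidences, Finset.card_image_of_injective]
  · simp only [Finset.card_product, Int.card_Ico, sub_zero, Int.toNat_natCast]
    have : ((K : ℤ) ^ 2).toNat = K ^ 2 := by
      rw [← Nat.cast_pow, Int.toNat_natCast]
    rw [this]; ring
  · rintro ⟨x, a, b⟩ ⟨x', a', b'⟩ h
    simp only [Prod.mk.injEq] at h ⊢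
    exact ⟨h.1.1, h.2⟩

/-- A box containing the points of `gridIncidences K`. -/
noncomputable def gridPoints (K : ℕ) : Finset (ℤ × ℤ) := Finset.Ico (0 : ℤ) K ×ˢ Finset.Ico (0 : ℤ) (2 * K ^ 2)

lemma card_gridPoints (K : ℕ) : (gridPoints K).card = 2 * K ^ 3 := by
  simp only [gridPoints, Finset.card_product, Int.card_Ico, sub_zero, Int.toNat_natCast]
  have : (2 * (K : ℤ) ^ 2).toNat = 2 * K ^ 2 := by
    rw [show (2 * (K : ℤ) ^ 2) = ((2 * K ^ 2 : ℕ) : ℤ) by push_cast; rfl, Int.toNat_natCast]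
  rw [this]; ring

lemma mem_gridPoints_of_mem {K : ℕ} {p ℓ : ℤ × ℤ} (h : (p, ℓ) ∈ gridIncidences K) :
    p ∈ gridPoints K := by
  obtain ⟨⟨h1, h2⟩, ⟨h3, h4⟩, ⟨h5, h6⟩, h7⟩ := mem_gridIncidences.1 h
  simp only [gridPoints, Finset.mem_product, Finset.mem_Ico]
  refine ⟨⟨h1, h2⟩, ?_, ?_⟩ <;> rw [h7]
  · positivity
  · nlinarith

lemma card_image_fst_gridIncidences_le (K : ℕ) :
    ((gridIncidences K).image Prod.fst).card ≤ 2 * K ^ 3 := by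
  rw [← card_gridPoints]
  refine Finset.card_le_card fun p hp => ?_
  obtain ⟨e, he, rfl⟩ := Finset.mem_image.1 hp
  exact mem_gridPoints_of_mem he

lemma card_image_snd_gridIncidences_le (K : ℕ) :
    ((gridIncidences K).image Prod.snd).card ≤ 2 * K ^ 3 := by
  have : ((gridIncidences K).image Prod.snd).card ≤
      (Finset.Ico (0 : ℤ) K ×ˢ Finset.Ico (0 : ℤ) (K ^ 2)).card := by
    refine Finset.card_le_card fun ℓ hℓ => ?_
    obtain ⟨⟨p, ℓ⟩, he, rfl⟩ := Finset.mem_image.1 hℓ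
    obtain ⟨-, h1, h2, -⟩ := mem_gridIncidences.1 he
    simp only [Finset.mem_product, Finset.mem_Ico]
    exact ⟨h1, h2⟩
  refine this.trans ?_
  simp only [Finset.card_product, Int.card_Ico, sub_zero, Int.toNat_natCast]
  have : ((K : ℤ) ^ 2).toNat = K ^ 2 := by
    rw [← Nat.cast_pow, Int.toNat_natCast]
  rw [this]
  nlinarith [pow_nonneg (Nat.zero_le K) 3]

lemma exists_int_divisors {z : ℤ} (hz : z ≠ 0) :
    ∃ U : Finset ℤ, U.card ≤ 2 * z.natAbs.divisors.card ∧ ∀ u : ℤ, u ∣ z → u ∈ U := by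
  refine ⟨z.natAbs.divisors.image (fun n : ℕ => (n : ℤ)) ∪ z.natAbs.divisors.image (fun n : ℕ => -(n : ℤ)),
    ?_, fun u hu => ?_⟩
  · have h1 := Finset.card_image_le (s := z.natAbs.divisors) (f := fun n : ℕ => (n : ℤ))
    have h2 := Finset.card_image_le (s := z.natAbs.divisors) (f := fun n : ℕ => -(n : ℤ))
    refine (Finset.card_union_le _ _).trans (by omega)
  · have h : u.natAbs ∈ z.natAbs.divisors :=
      Nat.mem_divisors.2 ⟨Int.natAbs_dvd_natAbs.2 hu, Int.natAbs_ne_zero.2 hz⟩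
    rw [Finset.mem_union, Finset.mem_image, Finset.mem_image]
    rcases Int.natAbs_eq u with hu' | hu'
    · exact Or.inl ⟨_, h, hu'.symm⟩
    · exact Or.inr ⟨_, h, hu'.symm⟩

/-- Two joined points of the grid have few common neighbours off the line joining them. -/
lemma exists_commonNeighbors {K D : ℕ}
    (hD : ∀ m : ℕ, m ≠ 0 → m ≤ K ^ 2 → m.divisors.card ≤ D) {v w : ℤ × ℤ} {c : ℤ}
    (hv : 0 ≤ v.1 ∧ v.1 < K) (hw : 0 ≤ w.1 ∧ w.1 < K) (hc : 0 ≤ c ∧ c < K)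
    (hvw : w.2 - v.2 = c * (w.1 - v.1)) (hne : v.1 ≠ w.1) :
    ∃ N : Finset (ℤ × ℤ), N.card ≤ 2 * K * D ∧ ∀ (q : ℤ × ℤ) (a b : ℤ), 0 ≤ b → b < K → b ≠ c →
      q.2 - v.2 = a * (q.1 - v.1) → q.2 - w.2 = b * (q.1 - w.1) → q ∈ N := by
  -- Eliminating `q.2` gives (a - b)(q.1 - v.1) = (c - b)(w.1 - v.1). The right side is nonzero and
  -- at most K² in absolute value, so for fixed `b` the difference `q.1 - v.1` is one of at most 2D
  -- divisors, and it determines `q`.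
  have hz : ∀ b : ℤ, b ≠ c → (c - b) * (w.1 - v.1) ≠ 0 := fun b hb =>
    mul_ne_zero (sub_ne_zero.2 hb.symm) (sub_ne_zero.2 hne.symm)
  have hU := fun (b : ℤ) (hb : b ≠ c) => exists_int_divisors (hz b hb)
  choose! U hUc hU using hU
  refine ⟨((Finset.Ico (0 : ℤ) K).filter (· ≠ c)).biUnion fun b =>
    (U b).image fun u => (v.1 + u, w.2 + b * (v.1 + u - w.1)), ?_, ?_⟩
  · refine (Finset.card_biUnion_le_card_mul _ _ (2 * D) fun b hb => ?_).trans ?_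
    · obtain ⟨hb1, hb2⟩ := Finset.mem_filter.1 hb
      rw [Finset.mem_Ico] at hb1
      refine Finset.card_image_le.trans ((hUc b hb2).trans ?_)
      refine Nat.mul_le_mul_left 2 (hD _ (Int.natAbs_ne_zero.2 (hz b hb2)) ?_)
      rw [Int.natAbs_mul, sq]
      exact Nat.mul_le_mul (by omega) (by omega)
    · have : ((Finset.Ico (0 : ℤ) K).filter (· ≠ c)).card ≤ K := by
        refine (Finset.card_filter_le _ _).trans ?_
        simp
      calc _ ≤ K * (2 * D) := Nat.mul_le_mul_right _ this
        _ = _ := by ring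
  · intro q a b hb0 hbK hbc h1 h2
    rw [Finset.mem_biUnion]
    refine ⟨b, by simp [hb0, hbK, hbc], Finset.mem_image.2 ⟨q.1 - v.1, hU b hbc _ ⟨a - b, ?_⟩, ?_⟩⟩
    · linear_combination h1 - h2 - hvw
    · ext
      · simp
      · simp only [add_sub_cancel]
        linarith

/-- The line `y = a x + b` through two lattice points, as the pair `(a, b)`, when it has integer
coefficients. -/
def lineThrough (p q : ℤ × ℤ) : ℤ × ℤ :=
  ((q.2 - p.2) / (q.1 - p.1), p.2 - (q.2 - p.2) / (q.1 - p.1) * p.1)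

lemma fst_ne_of_on_line {p q ℓ : ℤ × ℤ} (hpq : p ≠ q) (hp : p.2 = ℓ.1 * p.1 + ℓ.2)
    (hq : q.2 = ℓ.1 * q.1 + ℓ.2) : p.1 ≠ q.1 := fun h =>
  hpq (Prod.ext h (by rw [hp, hq, h]))

lemma lineThrough_eq {p q ℓ : ℤ × ℤ} (hpq : p ≠ q) (hp : p.2 = ℓ.1 * p.1 + ℓ.2)
    (hq : q.2 = ℓ.1 * q.1 + ℓ.2) : lineThrough p q = ℓ := by
  have hx := fst_ne_of_on_line hpq hp hq
  have h : (q.2 - p.2) / (q.1 - p.1) = ℓ.1 := by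
    apply Int.ediv_eq_of_eq_mul_left (sub_ne_zero.2 hx.symm)
    rw [hp, hq]; ring
  unfold lineThrough
  rw [h]
  ext
  · rfl
  · simp only; linarith

/-- The tuples of points that are pairwise joined by distinct lines of the grid. -/
structure IsCliqueTuple (K : ℕ) {s : ℕ} (p : Fin s → ℤ × ℤ) : Prop where
  injective : Function.Injective p
  mem : ∀ i j, i ≠ j → (p i, lineThrough (p i) (p j)) ∈ gridIncidences K
  symm : ∀ i j, i ≠ j → lineThrough (p i) (p j) = lineThrough (p j) (p i)
  distinct : ∀ i j i' j', i ≠ j → i' ≠ j' →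
    lineThrough (p i) (p j) = lineThrough (p i') (p j') → s(i, j) = s(i', j')

/-- The incidences used by a tuple of pairwise joined points. -/
def tupleIncidences {s : ℕ} (p : Fin s → ℤ × ℤ) : Finset ((ℤ × ℤ) × (ℤ × ℤ)) :=
  (Finset.univ : Finset (Fin s)).offDiag.image fun z => (p z.1, lineThrough (p z.1) (p z.2))

lemma IsCliqueTuple.tupleIncidences_subset {K s : ℕ} {p : Fin s → ℤ × ℤ}
    (h : IsCliqueTuple K p) : tupleIncidences p ⊆ gridIncidences K := by
  intro e he
  obtain ⟨⟨i, j⟩, hij, rfl⟩ := Finset.mem_image.1 he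
  exact h.mem i j (Finset.mem_offDiag.1 hij).2.2

/-- Ordered pairs are counted: each joining line contributes an incidence at both of its points. -/
lemma IsCliqueTuple.card_tupleIncidences {K s : ℕ} {p : Fin s → ℤ × ℤ}
    (h : IsCliqueTuple K p) : (tupleIncidences p).card = s * s - s := by
  rw [tupleIncidences, Finset.card_image_of_injOn, Finset.offDiag_card]
  · simp
  · rintro ⟨i, j⟩ hij ⟨i', j'⟩ hij' heq
    simp only [Prod.mk.injEq] at heq
    have hi := h.injective heq.1
    have hs := h.distinct i j i' j' (Finset.mem_offDiag.1 hij).2.2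
      (Finset.mem_offDiag.1 hij').2.2 heq.2
    subst hi
    rw [Sym2.congr_right] at hs
    rw [hs]

/-- Two distinct points determine their line, so a clique is encoded by its points alone and only
point tuples need counting. -/
lemma HasClique.exists_isCliqueTuple {K s : ℕ} {A : Finset ((ℤ × ℤ) × (ℤ × ℤ))}
    (hA : A ⊆ gridIncidences K) (h : HasClique A s) :
    ∃ p : Fin s → ℤ × ℤ, IsCliqueTuple K p ∧ tupleIncidences p ⊆ A := by
  obtain ⟨p, l, hp, hl, hd⟩ := h
  have key : ∀ i j, i ≠ j → lineThrough (p i) (p j) = l i j := by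
    intro i j hij
    have h1 := mem_gridIncidences.1 (hA (hl i j hij).1)
    have h2 := mem_gridIncidences.1 (hA (hl j i hij.symm).1)
    rw [← (hl i j hij).2] at h2
    exact lineThrough_eq (hp.ne hij) h1.2.2.2 h2.2.2.2
  refine ⟨p, ⟨hp, ?_, ?_, ?_⟩, ?_⟩
  · intro i j hij
    rw [key i j hij]
    exact hA (hl i j hij).1
  · intro i j hij
    rw [key i j hij, key j i hij.symm]
    exact (hl i j hij).2
  · intro i j i' j' hij hij'
    rw [key i j hij, key i' j' hij']
    exact hd i j i' j' hij hij'
  · intro e he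
    obtain ⟨⟨i, j⟩, hij, rfl⟩ := Finset.mem_image.1 he
    have hij := (Finset.mem_offDiag.1 hij).2.2
    simp only [key i j hij]
    exact (hl i j hij).1

open Classical in
/-- The clique tuples of the grid. -/
noncomputable def cliqueTuples (K s : ℕ) : Finset (Fin s → ℤ × ℤ) :=
  (Fintype.piFinset fun _ => gridPoints K).filter (IsCliqueTuple K)

lemma mem_cliqueTuples {K s : ℕ} (hs : 2 ≤ s) {p : Fin s → ℤ × ℤ} :
    p ∈ cliqueTuples K s ↔ IsCliqueTuple K p := by
  have : Nontrivial (Fin s) := Fin.nontrivial_iff_two_le.2 hs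
  simp only [cliqueTuples, Finset.mem_filter, Fintype.mem_piFinset, and_iff_right_iff_imp]
  intro h i
  obtain ⟨j, hj⟩ := exists_ne i
  exact mem_gridPoints_of_mem (h.mem i j hj.symm)

lemma card_cliqueTuples_le {K D : ℕ}
    (hD : ∀ m : ℕ, m ≠ 0 → m ≤ K ^ 2 → m.divisors.card ≤ D) (r : ℕ) :
    (cliqueTuples K (r + 2)).card ≤ (2 * K * D) ^ r * (2 * K ^ 5) := by
  classical
  -- A joined pair is encoded by its first point, the abscissa of the second and the slope: 2K³ · K
  -- · K choices.
  let pairs : Finset ((ℤ × ℤ) × (ℤ × ℤ)) :=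
    (gridPoints K ×ˢ (Finset.Ico (0 : ℤ) K ×ˢ Finset.Ico (0 : ℤ) K)).image
      fun z => (z.1, (z.2.1, z.1.2 + z.2.2 * (z.2.1 - z.1.1)))
  have hpairs : pairs.card ≤ 2 * K ^ 5 := by
    refine Finset.card_image_le.trans ?_
    simp only [Finset.card_product, card_gridPoints, Int.card_Ico, sub_zero, Int.toNat_natCast]
    exact le_of_eq (by ring)
  have h01 : (0 : Fin (r + 2)) ≠ 1 := by simp
  have hmaps : ∀ p ∈ cliqueTuples K (r + 2), (p 0, p 1) ∈ pairs := by
    intro p hp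
    rw [mem_cliqueTuples (by omega)] at hp
    have m0 := hp.mem 0 1 h01
    have m1 := hp.mem 1 0 h01.symm
    rw [hp.symm 1 0 h01.symm] at m1
    refine Finset.mem_image.2 ⟨(p 0, ((p 1).1, (lineThrough (p 0) (p 1)).1)), ?_, ?_⟩
    · simp only [Finset.mem_product, Finset.mem_Ico]
      exact ⟨mem_gridPoints_of_mem m0, (mem_gridIncidences.1 m1).1, (mem_gridIncidences.1 m0).2.1⟩
    · have e0 := (mem_gridIncidences.1 m0).2.2.2
      have e1 := (mem_gridIncidences.1 m1).2.2.2
      ext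
      · rfl
      · rfl
      · rfl
      · simp only
        linear_combination e0 - e1
  refine (Finset.card_le_mul_card_image_of_maps_to hmaps ((2 * K * D) ^ r) ?_).trans
    (Nat.mul_le_mul_left _ hpairs)
  rintro ⟨v, w⟩ -
  rcases Finset.eq_empty_or_nonempty
    {p ∈ cliqueTuples K (r + 2) | (p 0, p 1) = (v, w)} with hem | ⟨p₀, hp₀⟩
  · rw [hem]; simp
  simp only [Finset.mem_filter, mem_cliqueTuples (show 2 ≤ r + 2 by omega), Prod.mk.injEq] at hp₀
  obtain ⟨hp₀, rfl, rfl⟩ := hp₀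
  have m0 := hp₀.mem 0 1 h01
  have m1 := hp₀.mem 1 0 h01.symm
  rw [hp₀.symm 1 0 h01.symm] at m1
  rw [mem_gridIncidences] at m0 m1
  obtain ⟨N, hNc, hN⟩ := exists_commonNeighbors hD m0.1 m1.1 m0.2.1
    (by linear_combination m1.2.2.2 - m0.2.2.2)
    (fst_ne_of_on_line (hp₀.injective.ne h01) m0.2.2.2 m1.2.2.2)
  have hsub : {p ∈ cliqueTuples K (r + 2) | (p 0, p 1) = (p₀ 0, p₀ 1)} ⊆
      Fintype.piFinset (Fin.cons {p₀ 0} (Fin.cons {p₀ 1} fun _ : Fin r => N) :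
        Fin (r + 2) → Finset (ℤ × ℤ)) := by
    intro p hp
    simp only [Finset.mem_filter, mem_cliqueTuples (show 2 ≤ r + 2 by omega), Prod.mk.injEq] at hp
    obtain ⟨hp, e0, e1⟩ := hp
    rw [Fintype.mem_piFinset]
    intro i
    refine Fin.cases ?_ (fun i => ?_) i
    · simpa using e0
    refine Fin.cases ?_ (fun i => ?_) i
    · simpa using e1
    simp only [Fin.cons_succ]
    set k : Fin (r + 2) := i.succ.succ with hk
    have hk0 : k ≠ 0 := Fin.succ_ne_zero _
    have hk1 : k ≠ 1 := by
      rw [hk, ← Fin.succ_zero_eq_one]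
      exact fun h => Fin.succ_ne_zero _ (Fin.succ_injective _ h)
    have a0 := (mem_gridIncidences.1 (hp.mem 0 k hk0.symm)).2.2.2
    have a1 := (mem_gridIncidences.1 (hp.mem k 0 hk0)).2.2.2
    rw [hp.symm k 0 hk0] at a1
    have b0 := mem_gridIncidences.1 (hp.mem 1 k hk1.symm)
    have b1 := (mem_gridIncidences.1 (hp.mem k 1 hk1)).2.2.2
    rw [hp.symm k 1 hk1] at b1
    rw [e0] at a0 a1
    rw [e1] at b0 b1
    refine hN _ (lineThrough (p₀ 0) (p k)).1 (lineThrough (p₀ 1) (p k)).1 b0.2.1.1 b0.2.1.2 ?_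
      (by linear_combination a1 - a0) (by linear_combination b1 - b0.2.2.2)
    -- Equal slopes would put `p k` on the line of `p 0` and `p 1`, against the distinctness of the
    -- joining lines.
    intro hbc
    have hl : lineThrough (p 1) (p k) = lineThrough (p 0) (p 1) := by
      rw [e0, e1]
      refine Prod.ext hbc ?_
      have := b0.2.2.2
      rw [hbc] at this
      linear_combination m1.2.2.2 - this
    have := hp.distinct 1 k 0 1 hk1.symm h01 hl
    rw [Sym2.eq_iff] at this
    rcases this with ⟨h, -⟩ | ⟨-, h⟩
    · exact h01 h.symm
    · exact hk0 h
  refine (Finset.card_le_card hsub).trans ?_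
  rw [Fintype.card_piFinset, Fin.prod_univ_succ, Fin.prod_univ_succ]
  simp only [Fin.cons_zero, Fin.cons_succ, Finset.card_singleton, one_mul, Finset.prod_const,
    Finset.card_univ, Fintype.card_fin]
  exact Nat.pow_le_pow_left hNc r

lemma exists_cliqueFree_of_card_divisors_le {K D r k : ℕ} (hk : 1 ≤ k)
    (hD : ∀ m : ℕ, m ≠ 0 → m ≤ K ^ 2 → m.divisors.card ≤ D) :
    ∃ A ⊆ gridIncidences K, ¬ HasClique A (r + 2) ∧
      (K : ℝ) ^ 4 / k - (2 * K * D) ^ r * (2 * K ^ 5) / (k : ℝ) ^ ((r + 2) * (r + 2) - (r + 2)) ≤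
        A.card := by
  have ht : 1 ≤ (r + 2) * (r + 2) - (r + 2) := Nat.le_sub_of_add_le (by nlinarith)
  obtain ⟨A, hA, hfree, hcard⟩ := exists_independent (gridIncidences K) (cliqueTuples K (r + 2))
    tupleIncidences ht (fun p hp => by
      rw [mem_cliqueTuples (by omega)] at hp
      exact ⟨hp.tupleIncidences_subset, hp.card_tupleIncidences⟩) hk
  refine ⟨A, hA, fun h => ?_, le_trans ?_ hcard⟩
  · obtain ⟨p, hp, hpA⟩ := h.exists_isCliqueTuple hA
    exact hfree p ((mem_cliqueTuples (by omega)).2 hp) hpA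
  · have hB : ((cliqueTuples K (r + 2)).card : ℝ) ≤ (2 * K * D) ^ r * (2 * K ^ 5) := by
      exact_mod_cast card_cliqueTuples_le hD r
    rw [card_gridIncidences]
    push_cast
    gcongr

/-! ### Optimizing the deletion -/

/-- Choosing the density of the random deletion. -/
lemma exists_deletion_parameter {X Y : ℝ} (hX : 0 < X) (hY : X ≤ 2 * Y) {t : ℕ} (ht : 2 ≤ t) :
    ∃ k : ℕ, 1 ≤ k ∧ X / (4 * (2 * Y / X) ^ (1 / ((t : ℝ) - 1))) ≤ X / k - Y / (k : ℝ) ^ t := by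
  have hY0 : 0 < Y := by linarith
  have hq : 1 ≤ 2 * Y / X := by rw [le_div_iff₀ hX]; linarith
  have ht1 : (0 : ℝ) < (t : ℝ) - 1 := by
    have : (2 : ℝ) ≤ t := by exact_mod_cast ht
    linarith
  -- At k = z the loss Y/k^t is exactly half of the gain X/k. Rounding `z` up keeps the loss at most
  -- half and costs at most a factor 2.
  set z := (2 * Y / X) ^ (1 / ((t : ℝ) - 1)) with hz
  have hz1 : 1 ≤ z := Real.one_le_rpow hq (by positivity)
  have hzk : z ≤ (⌈z⌉₊ : ℝ) := Nat.le_ceil z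
  have hk2 : (⌈z⌉₊ : ℝ) ≤ 2 * z := by
    have := Nat.ceil_lt_add_one (show 0 ≤ z by linarith)
    linarith
  set k := ⌈z⌉₊ with hk
  have hk0 : (0 : ℝ) < k := by linarith
  refine ⟨k, by exact_mod_cast hz1.trans hzk, ?_⟩
  have hpow : 2 * Y / X ≤ (k : ℝ) ^ (t - 1) := by
    calc 2 * Y / X = z ^ (t - 1) := by
          rw [hz, ← Real.rpow_natCast, ← Real.rpow_mul (by positivity), Nat.cast_sub (by omega)]
          push_cast
          rw [one_div_mul_cancel ht1.ne', Real.rpow_one]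
      _ ≤ _ := by gcongr
  have h1 : Y / (k : ℝ) ^ t ≤ X / (2 * k) := by
    rw [div_le_iff₀ hX] at hpow
    rw [div_le_div_iff₀ (by positivity) (by positivity),
      show (k : ℝ) ^ t = k ^ (t - 1) * k by rw [← pow_succ]; congr 1; omega]
    nlinarith
  have h2 : X / (4 * z) ≤ X / (2 * k) := by
    apply div_le_div_of_nonneg_left hX.le (by positivity)
    linarith
  have h3 : X / k = X / (2 * k) + X / (2 * k) := by field_simp; ring
  linarith

lemma exists_cliqueFree_grid {r : ℕ} (hr : 1 ≤ r) {ε : ℝ} (hε : 0 < ε) :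
    ∃ c : ℝ, 0 < c ∧ ∀ K : ℕ, 1 ≤ K → ∃ A ⊆ gridIncidences K, ¬ HasClique A (r + 2) ∧
      c * (K : ℝ) ^ (4 - ((r : ℝ) + 1) / (((r : ℝ) + 2) ^ 2 - (r + 2) - 1) - ε) ≤ A.card := by
  set τ : ℝ := ((r : ℝ) + 2) ^ 2 - (r + 2) - 1 with hτ
  have hr0 : (0 : ℝ) < r := by exact_mod_cast hr
  have hτ0 : 0 < τ := by rw [hτ]; nlinarith
  have htt : (((r + 2) * (r + 2) - (r + 2) : ℕ) : ℝ) - 1 = τ := by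
    rw [Nat.cast_sub (by nlinarith)]; push_cast; ring
  -- Divisors are taken of numbers up to K² and the bound enters to the power `r`, so this exponent
  -- contributes K^(ετ), which the later τ-th root turns into K^ε.
  obtain ⟨C, hC1, hC⟩ := card_divisors_le_rpow (show 0 < ε * τ / (2 * r) by positivity)
  set C' : ℝ := 4 * (2 * C) ^ r with hC'
  have hC'0 : 0 < C' := by positivity
  have hC'1 : 1 ≤ C' := by
    have : 1 ≤ (2 * C) ^ r := one_le_pow₀ (by linarith)
    rw [hC']; linarith
  refine ⟨(4 * C' ^ (1 / τ))⁻¹, by positivity, fun K hK => ?_⟩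
  have hK1 : (1 : ℝ) ≤ K := by exact_mod_cast hK
  have hK0 : (0 : ℝ) < K := by linarith
  set η : ℝ := ε * τ / (2 * r) with hη
  have hη0 : 0 < η := by positivity
  set D := ⌊C * (K : ℝ) ^ (2 * η)⌋₊ with hD
  have hDle : (D : ℝ) ≤ C * (K : ℝ) ^ (2 * η) := Nat.floor_le (by positivity)
  have hdiv : ∀ m : ℕ, m ≠ 0 → m ≤ K ^ 2 → m.divisors.card ≤ D := by
    intro m hm hmK
    refine Nat.le_floor ((hC m hm).trans ?_)
    have : (m : ℝ) ≤ (K : ℝ) ^ 2 := by exact_mod_cast hmK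
    rw [Real.rpow_mul hK0.le]
    norm_cast at *
    gcongr
  set Y : ℝ := (2 * K * (C * (K : ℝ) ^ (2 * η))) ^ r * (2 * K ^ 5) with hYdef
  have hq : 2 * Y / (K : ℝ) ^ 4 = C' * (K : ℝ) ^ ((r : ℝ) + 1 + ε * τ) := by
    have e1 : ((K : ℝ) ^ (2 * η)) ^ r = (K : ℝ) ^ (ε * τ) := by
      rw [← Real.rpow_natCast, ← Real.rpow_mul hK0.le]
      congr 1
      rw [hη]; field_simp
    rw [Real.rpow_add hK0, ← e1, hYdef, hC',
      show (r : ℝ) + 1 = ((r + 1 : ℕ) : ℝ) by push_cast; rfl, Real.rpow_natCast,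
      div_eq_iff (by positivity)]
    simp only [mul_pow, pow_succ]
    ring
  have hXY : (K : ℝ) ^ 4 ≤ 2 * Y := by
    have h1 : 1 ≤ 2 * Y / (K : ℝ) ^ 4 := by
      rw [hq]
      exact one_le_mul_of_one_le_of_one_le hC'1 (Real.one_le_rpow hK1 (by positivity))
    rwa [le_div_iff₀ (by positivity), one_mul] at h1
  obtain ⟨k, hk, hkle⟩ := exists_deletion_parameter (show (0 : ℝ) < (K : ℝ) ^ 4 by positivity) hXY
    (show 2 ≤ (r + 2) * (r + 2) - (r + 2) from Nat.le_sub_of_add_le (by nlinarith))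
  obtain ⟨A, hA, hfree, hcard⟩ := exists_cliqueFree_of_card_divisors_le (r := r) hk hdiv
  refine ⟨A, hA, hfree, le_trans (le_trans ?_ hkle) (le_trans ?_ hcard)⟩
  · rw [htt, hq, Real.mul_rpow hC'0.le (by positivity), ← Real.rpow_mul hK0.le]
    apply le_of_eq
    have e2 : 4 - ((r : ℝ) + 1) / τ - ε = (4 : ℕ) - ((r : ℝ) + 1 + ε * τ) * (1 / τ) := by
      push_cast; field_simp; ring
    rw [e2, Real.rpow_sub hK0, Real.rpow_natCast]
    field_simp
  · rw [hYdef]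
    gcongr

/-- A clique-free set of many grid incidences, with the numbers of points and lines at most `n`. -/
lemma exists_cliqueFree {s : ℕ} (hs : 3 ≤ s) {ε : ℝ} (hε : 0 < ε) (hε1 : ε ≤ 1) :
    ∃ c : ℝ, 0 < c ∧ ∀ n : ℕ, 2 ≤ n → ∃ A : Finset ((ℤ × ℤ) × (ℤ × ℤ)), IsLineIncidences A ∧
      (A.image Prod.fst).card ≤ n ∧ (A.image Prod.snd).card ≤ n ∧ ¬ HasClique A s ∧
      c * (n : ℝ) ^ ((4 : ℝ) / 3 - ((s : ℝ) - 1) / (3 * ((s : ℝ) ^ 2 - s - 1)) - ε / 3) ≤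
        A.card := by
  obtain ⟨r, rfl⟩ : ∃ r, s = r + 2 := ⟨s - 2, by omega⟩
  have hr : 1 ≤ r := by omega
  obtain ⟨c, hc, h⟩ := exists_cliqueFree_grid hr hε
  have hr0 : (1 : ℝ) ≤ r := by exact_mod_cast hr
  have hτ0 : 0 < ((r : ℝ) + 2) ^ 2 - (r + 2) - 1 := by nlinarith
  set θ : ℝ := 4 - ((r : ℝ) + 1) / (((r : ℝ) + 2) ^ 2 - (r + 2) - 1) - ε with hθ
  have hθ0 : 0 ≤ θ := by
    have : ((r : ℝ) + 1) / (((r : ℝ) + 2) ^ 2 - (r + 2) - 1) ≤ 1 := by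
      rw [div_le_one hτ0]; nlinarith
    linarith
  refine ⟨c * ((16 : ℝ) ^ (θ / 3))⁻¹, by positivity, fun n hn => ?_⟩
  -- For the largest such K, n < 2(K + 1)³ ≤ 2(2K)³ = 16K³.
  obtain ⟨K, hK1, hKn, hnK⟩ : ∃ K : ℕ, 1 ≤ K ∧ 2 * K ^ 3 ≤ n ∧ n ≤ 16 * K ^ 3 := by
    have hP : 2 * 1 ^ 3 ≤ n := by omega
    have hle : 1 ≤ Nat.findGreatest (fun K => 2 * K ^ 3 ≤ n) n :=
      Nat.le_findGreatest (by omega) hP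
    have hspec := Nat.findGreatest_spec (P := fun K => 2 * K ^ 3 ≤ n) (by omega : 1 ≤ n) hP
    refine ⟨_, hle, hspec, ?_⟩
    set K := Nat.findGreatest (fun K => 2 * K ^ 3 ≤ n) n
    by_contra hcon
    have h1 : 2 * (K + 1) ^ 3 ≤ n := by
      have : (K + 1) ^ 3 ≤ (2 * K) ^ 3 := Nat.pow_le_pow_left (by omega) 3
      have e : (2 * K) ^ 3 = 8 * K ^ 3 := by ring
      omega
    have h2 : K + 1 ≤ n := by
      have : K + 1 ≤ (K + 1) ^ 3 := Nat.le_self_pow (by norm_num) _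
      omega
    have := Nat.le_findGreatest (P := fun K => 2 * K ^ 3 ≤ n) h2 h1
    omega
  obtain ⟨A, hA, hfree, hcard⟩ := h K hK1
  refine ⟨A, fun e he => isLineIncidences_gridIncidences K e (hA he), ?_, ?_, hfree, le_trans ?_ hcard⟩
  · exact (Finset.card_le_card (Finset.image_subset_image hA)).trans
      ((card_image_fst_gridIncidences_le K).trans hKn)
  · exact (Finset.card_le_card (Finset.image_subset_image hA)).trans
      ((card_image_snd_gridIncidences_le K).trans hKn)
  · have hexp : (4 : ℝ) / 3 - (((r + 2 : ℕ) : ℝ) - 1) /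
        (3 * (((r + 2 : ℕ) : ℝ) ^ 2 - (r + 2 : ℕ) - 1)) - ε / 3 = θ / 3 := by
      rw [hθ]
      push_cast
      field_simp
      ring
    rw [hexp, mul_assoc]
    apply mul_le_mul_of_nonneg_left _ hc.le
    rw [inv_mul_le_iff₀ (by positivity)]
    have h1 : (n : ℝ) ≤ 16 * (K : ℝ) ^ 3 := by exact_mod_cast hnK
    calc (n : ℝ) ^ (θ / 3) ≤ (16 * (K : ℝ) ^ 3) ^ (θ / 3) := by gcongr
      _ = 16 ^ (θ / 3) * (K : ℝ) ^ θ := by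
        rw [Real.mul_rpow (by norm_num) (by positivity), ← Real.rpow_natCast (K : ℝ) 3,
          ← Real.rpow_mul (by positivity)]
        congr 2
        push_cast; ring

/-! ### From each ε to a single error sequence -/

/-- `m` is the number of incidences of some admissible configuration of `n` points and `n`
pseudo-segments. -/
def IsIncidenceCount (s n m : ℕ) : Prop :=
  ∃ (P : Finset Plane) (C : Finset (Set Plane)),
    P.card = n ∧ C.card = n ∧ IsPseudoSegmentFamily C ∧
    (¬ ∃ S : Finset Plane, S ⊆ P ∧ S.card = s ∧ PairsOnDistinctCurves S C) ∧
    incidences P C = m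

lemma IsIncidenceCount.le {s n m : ℕ} (h : IsIncidenceCount s n m) : m ≤ n * n := by
  obtain ⟨P, C, rfl, hC, -, -, rfl⟩ := h
  classical
  refine (Finset.card_filter_le _ _).trans ?_
  rw [Finset.card_product, hC]

lemma isIncidenceCount_one {s n : ℕ} (hs : 3 ≤ s) (hn : 1 ≤ n) : IsIncidenceCount s n 1 := by
  have h : ¬ HasClique {((0, 0), (0, 0))} s := by
    rintro ⟨p, l, hp, hl, -⟩
    have h01 : (⟨0, by omega⟩ : Fin s) ≠ ⟨1, by omega⟩ := by simp
    have h0 := (hl _ _ h01).1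
    have h1 := (hl _ _ h01.symm).1
    simp only [Finset.mem_singleton, Prod.mk.injEq] at h0 h1
    exact h01 (hp (h0.1.trans h1.1.symm))
  exact exists_pseudoSegments (E := {((0, 0), (0, 0))}) (by simp [IsLineIncidences])
    (by simpa using hn) (by simpa using hn) h

lemma eventually_isIncidenceCount {s : ℕ} (hs : 3 ≤ s) {ε : ℝ} (hε : 0 < ε) (hε1 : ε ≤ 1) :
    ∀ᶠ n : ℕ in Filter.atTop, ∃ m, IsIncidenceCount s n m ∧
      (n : ℝ) ^ ((4 : ℝ) / 3 - ((s : ℝ) - 1) / (3 * ((s : ℝ) ^ 2 - s - 1)) - ε) ≤ m := by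
  obtain ⟨c, hc, h⟩ := exists_cliqueFree hs hε hε1
  -- Only ε/3 of the allowed loss ε has been spent; the remaining n^(2ε/3) absorbs the constant `c`.
  have htend : Filter.Tendsto (fun n : ℕ => c * (n : ℝ) ^ (2 * ε / 3)) Filter.atTop Filter.atTop :=
    ((tendsto_rpow_atTop (by positivity)).comp tendsto_natCast_atTop_atTop).const_mul_atTop hc
  filter_upwards [htend.eventually_ge_atTop 1, Filter.eventually_ge_atTop 2] with n hn1 hn2
  obtain ⟨A, hA, h1, h2, hfree, hcard⟩ := h n hn2
  refine ⟨A.card, exists_pseudoSegments hA h1 h2 hfree, le_trans ?_ hcard⟩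
  have hn0 : (0 : ℝ) < n := by exact_mod_cast (by omega : 0 < n)
  set e := (4 : ℝ) / 3 - ((s : ℝ) - 1) / (3 * ((s : ℝ) ^ 2 - s - 1)) with he
  calc (n : ℝ) ^ (e - ε) ≤ (c * (n : ℝ) ^ (2 * ε / 3)) * (n : ℝ) ^ (e - ε) :=
        le_mul_of_one_le_left (by positivity) hn1
    _ = c * (n : ℝ) ^ (e - ε / 3) := by
        rw [mul_assoc, ← Real.rpow_add hn0]
        congr 2
        ring

theorem theorem1p4 (s : ℕ) (hs : 3 ≤ s) :
    ∃ δ : ℕ → ℝ, Filter.Tendsto δ Filter.atTop (nhds 0) ∧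
      ∀ n : ℕ, 1 ≤ n →
        ∃ (P : Finset Plane) (C : Finset (Set Plane)),
          P.card = n ∧ C.card = n ∧ IsPseudoSegmentFamily C ∧
          (¬ ∃ S : Finset Plane, S ⊆ P ∧ S.card = s ∧ PairsOnDistinctCurves S C) ∧
          (n : ℝ) ^ ((4 : ℝ) / 3 - ((s : ℝ) - 1) / (3 * ((s : ℝ) ^ 2 - (s : ℝ) - 1)) - δ n)
            ≤ (incidences P C : ℝ) := by
  set e := (4 : ℝ) / 3 - ((s : ℝ) - 1) / (3 * ((s : ℝ) ^ 2 - s - 1)) with he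
  have hbdd : ∀ n, BddAbove {m | IsIncidenceCount s n m} := fun n => ⟨n * n, fun m hm => hm.le⟩
  set f : ℕ → ℕ := fun n => sSup {m | IsIncidenceCount s n m} with hf
  have hf1 : ∀ n, 1 ≤ n → 1 ≤ f n := fun n hn => le_csSup (hbdd n) (isIncidenceCount_one hs hn)
  have hfmem : ∀ n, 1 ≤ n → IsIncidenceCount s n (f n) := fun n hn =>
    Nat.sSup_mem ⟨1, isIncidenceCount_one hs hn⟩ (hbdd n)
  -- The maximal incidence count `f n` serves every ε at once. The error is the shortfall of its
  -- exponent, truncated at 0 so that a surplus does not spoil convergence.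
  refine ⟨fun n => max 0 (e - Real.log (f n) / Real.log n), ?_, fun n hn => ?_⟩
  · rw [Metric.tendsto_nhds]
    intro ε hε
    have hε' : 0 < min (ε / 2) 1 := by positivity
    filter_upwards [eventually_isIncidenceCount hs hε' (min_le_right _ _),
      Filter.eventually_ge_atTop 2] with n ⟨m, hm, hle⟩ hn
    have hn1 : (1 : ℝ) < n := by exact_mod_cast hn
    have hlog : 0 < Real.log n := Real.log_pos hn1
    have h1 : (n : ℝ) ^ (e - min (ε / 2) 1) ≤ f n :=
      hle.trans (by exact_mod_cast le_csSup (hbdd n) hm)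
    have h2 := Real.log_le_log (by positivity) h1
    rw [Real.log_rpow (by linarith), ← le_div_iff₀ hlog] at h2
    have h3 := min_le_left (ε / 2) 1
    rw [Real.dist_eq, sub_zero, abs_of_nonneg (le_max_left _ _)]
    exact max_lt hε (by linarith)
  · obtain ⟨P, C, hP, hC, hfam, hS, hI⟩ := hfmem n hn
    refine ⟨P, C, hP, hC, hfam, hS, ?_⟩
    rw [hI]
    have hf0 : (1 : ℝ) ≤ f n := by exact_mod_cast hf1 n hn
    rcases hn.eq_or_lt with rfl | hn2
    -- For n = 1 the logarithmic quotient is a default value, but the base 1 makes the exponent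
    -- irrelevant.
    · simpa using hf0
    have hn1 : (1 : ℝ) < n := by exact_mod_cast hn2
    have hlog : 0 < Real.log n := Real.log_pos hn1
    calc (n : ℝ) ^ (e - max 0 (e - Real.log (f n) / Real.log n))
        ≤ (n : ℝ) ^ (Real.log (f n) / Real.log n) := by
          apply Real.rpow_le_rpow_of_exponent_le hn1.le
          linarith [le_max_right 0 (e - Real.log (f n) / Real.log n)]
      _ = f n := by
          rw [Real.rpow_def_of_pos (by linarith), mul_div_cancel₀ _ hlog.ne',
            Real.exp_log (by linarith)]
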